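/- Let $\mathbb D$ be the open unit disk. Let $f=h+\overline g$ be a locally univalent, orientation-preserving, complex-valued harmonic function in $\mathbb D$ with $h,g$ holomorphic in $\mathbb D$, $h(0)=g(0)=g'(0)=0$ and $h'(0)=1$, such that $f(\mathbb D)$ is a convex domain (that is, $f\in\mathcal K_H^0$). Let $k(z)=\frac{z}{(1-z)^2}$ be the Koebe function, let $\ell(z)=\frac{z}{1-z}$, and let $L(z)=\frac12\left[(\ell(z)+k(z))+\overline{(\ell(z)-k(z))}\right]$ be the half-plane harmonic mapping. A rotation of a function $F$ on $\mathbb D$ is a function of the form $F_\lambda(z)=\overline\lambda F(\lambda z)$ with $|\lambda|=1$. If there exists a real number $\mu$ such that $h-e^{-2i\mu}g$ equals a rotation of $k$ in $\mathbb D$, then $f$ is a rotation of $L$. -/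

import Mathlib

open scoped ComplexConjugate

namespace ConvexHarmonic

/-- The open unit disk of the complex plane. -/
def unitDisk : Set ℂ := Metric.ball (0 : ℂ) 1

/-- `f` is locally univalent in the unit disk: every point of the disk has a neighbourhood on which
`f` is injective. -/
def LocallyUnivalent (f : ℂ → ℂ) : Prop :=
  ∀ z ∈ unitDisk, ∃ U ∈ nhds z, Set.InjOn f U

/-- `f` is orientation-preserving in the unit disk: the Jacobian determinant of `f`, as a map of the
real plane, is positive at every point of the disk. -/
def OrientationPreserving (f : ℂ → ℂ) : Prop :=
  ∀ z ∈ unitDisk, 0 < (fderiv ℝ f z).det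

/-- The function `f`, with decomposition `f = h + conj g` in the unit disk, belongs to the class
`K_H` of normalized convex harmonic mappings. Only the values in the unit disk matter. -/
structure MemKH (f h g : ℂ → ℂ) : Prop where
  harmonic : InnerProductSpace.HarmonicOnNhd f unitDisk
  holomorphic_h : DifferentiableOn ℂ h unitDisk
  holomorphic_g : DifferentiableOn ℂ g unitDisk
  decomposition : ∀ z ∈ unitDisk, f z = h z + conj (g z)
  locallyUnivalent : LocallyUnivalent f
  orientationPreserving : OrientationPreserving f
  h_zero : h 0 = 0
  g_zero : g 0 = 0
  deriv_h_zero : deriv h 0 = 1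
  isOpen_range : IsOpen (f '' unitDisk)
  convex_range : Convex ℝ (f '' unitDisk)

/-- The class `K_H^0`: the functions `f = h + conj g` of `K_H` with `g'(0) = 0`. -/
structure MemKH0 (f h g : ℂ → ℂ) : Prop extends MemKH f h g where
  deriv_g_zero : deriv g 0 = 0

/-- The half-plane function `ℓ(z) = z / (1 - z)`. -/
noncomputable def ell (z : ℂ) : ℂ := z / (1 - z)

/-- The Koebe function `k(z) = z / (1 - z) ^ 2`. -/
noncomputable def koebe (z : ℂ) : ℂ := z / (1 - z) ^ 2

/-- The half-plane harmonic mapping `L = ((ℓ + k) + conj (ℓ - k)) / 2`. -/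
noncomputable def halfPlaneMap (z : ℂ) : ℂ :=
  (1 / 2) * ((ell z + koebe z) + conj (ell z - koebe z))

/-- `F` is, in the unit disk, a rotation of `G`: there is a unimodular `c` with
`F(z) = conj c * G(c * z)` for all `z` in the disk. -/
def IsRotationOf (F G : ℂ → ℂ) : Prop :=
  ∃ c : ℂ, ‖c‖ = 1 ∧ ∀ z ∈ unitDisk, F z = conj c * G (c * z)

end ConvexHarmonic

/-! In the coordinate ζ = (1+z)/(1-z) of the right half-plane, `koebe` becomes (ζ²-1)/4 and `ell`
becomes (ζ-1)/2. Write the rotated map as H + conj G, so that bH - conj(b)G = b(ζ²-1)/4 with |b| =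
1, and put T = bH + conj(b)G. Then |G'| < |H'| gives T' = bζP with Re P > 0, and b(H + conj G) has
real part Re T and imaginary part Im(b(ζ²-1)/4).

In sectors Re T has a limit a at the origin (`exists_sectorial_limit`). If b is not real, the points
of the image at the height of the slit tip -b/4 come from two rays, with Re T > a on one and Re T <
a on the other; the skipped value a contradicts convexity (`im_eq_zero_of_convex`). So b = ±1, and b
can be dropped.

Now the image omits the real point a, and a separating line there yields R = T - κi(ζ²-1)/4 - a with
Re R > 0. As dR/d(ζ²) has positive real part, Re R increases along horizontal lines in the ζ²-plane,
which carries its smallness in a sector at the origin to the whole imaginary axis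
(`exists_re_le_sqrt`). Phragmén–Lindelöf then forces Re R = C Re ζ (`re_mul_re_le_of_le_sqrt`). The
normalization at ζ = 1 gives κ = 0 and C = 1/2, so T is affine (`eq_affine_of_convex`), which
identifies the half-plane mapping. -/

namespace ConvexHarmonic

open Complex Set Metric

/-! ### Schwarz–Pick, Harnack and growth in the half-plane. -/

/-- The open right half-plane. -/
def rightHalfPlane : Set ℂ := {ζ | 0 < ζ.re}

lemma isOpen_rightHalfPlane : IsOpen rightHalfPlane := isOpen_lt continuous_const continuous_re

/-- The ratio |u-v|/|u+conj v| is the pseudo-hyperbolic distance of the half-plane; its deficit from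
1 is governed by the real parts, which is how Schwarz–Pick turns into Harnack. -/
lemma normSq_sub_conj_identity (u v : ℂ) :
    ‖u - v‖ ^ 2 = ‖u + conj v‖ ^ 2 - 4 * (u.re * v.re) := by
  simp only [← normSq_eq_norm_sq, normSq_apply, sub_re, sub_im, add_re, add_im, conj_re, conj_im]
  ring

lemma re_add_conj_pos {u v : ℂ} (hu : 0 < u.re) (hv : 0 < v.re) : 0 < (u + conj v).re := by
  simp only [add_re, conj_re]; linarith

lemma add_conj_ne_zero {u v : ℂ} (hu : 0 < u.re) (hv : 0 < v.re) : u + conj v ≠ 0 := by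
  intro h
  have := re_add_conj_pos hu hv
  simp [h] at this

lemma norm_sub_lt_norm_add_conj {u v : ℂ} (hu : 0 < u.re) (hv : 0 < v.re) :
    ‖u - v‖ < ‖u + conj v‖ := by
  refine lt_of_pow_lt_pow_left₀ 2 (norm_nonneg _) ?_
  rw [normSq_sub_conj_identity]
  have := mul_pos hu hv
  linarith

lemma re_moebius_pos {a z : ℂ} (ha : 0 < a.re) (hz : ‖z‖ < 1) :
    0 < ((a + conj a * z) / (1 - z)).re := by
  have hne : (1 - z) ≠ 0 := by
    intro h
    rw [sub_eq_zero] at h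
    simp [← h] at hz
  have h1 : 0 < normSq (1 - z) := normSq_pos.2 hne
  have h2 : normSq z < 1 := by rw [normSq_eq_norm_sq]; exact pow_lt_one₀ (norm_nonneg _) hz two_ne_zero
  have : ((a + conj a * z) / (1 - z)).re = a.re * (1 - normSq z) / normSq (1 - z) := by
    rw [div_re]
    field_simp
    simp [normSq_apply]
    ring
  rw [this]
  exact div_pos (mul_pos ha (by linarith)) h1

/-- The Schwarz–Pick inequality for self-maps of the right half-plane. -/
theorem schwarz_pick_rightHalfPlane {φ : ℂ → ℂ} (hd : DifferentiableOn ℂ φ rightHalfPlane)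
    (hpos : ∀ ζ ∈ rightHalfPlane, 0 < (φ ζ).re) {ζ ω : ℂ} (hζ : 0 < ζ.re) (hω : 0 < ω.re) :
    ‖φ ζ - φ ω‖ * ‖ζ + conj ω‖ ≤ ‖φ ζ + conj (φ ω)‖ * ‖ζ - ω‖ := by
  set m : ℂ → ℂ := fun z => (ω + conj ω * z) / (1 - z) with hm
  have hmH : ∀ z ∈ ball (0 : ℂ) 1, m z ∈ rightHalfPlane := fun z hz =>
    re_moebius_pos hω (by simpa using hz)
  have hm0 : m 0 = ω := by simp [hm]
  have hmd : DifferentiableOn ℂ m (ball 0 1) := by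
    refine DifferentiableOn.div (by fun_prop) (by fun_prop) ?_
    intro z hz h
    rw [sub_eq_zero] at h
    simp [← h] at hz
  -- Both sides are moved to the disk with ω and φ ω sent to 0, so the Schwarz lemma applies.
  set F : ℂ → ℂ := fun z => (φ (m z) - φ ω) / (φ (m z) + conj (φ ω)) with hF
  have hcomp : DifferentiableOn ℂ (fun z => φ (m z)) (ball 0 1) := hd.comp hmd hmH
  have hFd : DifferentiableOn ℂ F (ball 0 1) :=
    (hcomp.sub_const _).div (hcomp.add_const _) fun z hz =>
      add_conj_ne_zero (hpos _ (hmH z hz)) (hpos _ hω)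
  have hFmaps : MapsTo F (ball 0 1) (closedBall 0 1) := by
    intro z hz
    rw [mem_closedBall_zero_iff, norm_div]
    exact div_le_one_of_le₀
      (norm_sub_lt_norm_add_conj (hpos _ (hmH z hz)) (hpos _ hω)).le (norm_nonneg _)
  have hne := add_conj_ne_zero hζ hω
  have hnorm : 0 < ‖ζ + conj ω‖ := norm_pos_iff.2 hne
  have hz : ‖(ζ - ω) / (ζ + conj ω)‖ < 1 := by
    rw [norm_div, div_lt_one hnorm]
    exact norm_sub_lt_norm_add_conj hζ hω
  have key := norm_le_norm_of_mapsTo_ball hFd hFmaps (by simp [hF, hm0]) hz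
  have hmz : m ((ζ - ω) / (ζ + conj ω)) = ζ := by
    have h2 := add_conj_ne_zero hω hω
    have h3 : (1 - (ζ - ω) / (ζ + conj ω)) = (ω + conj ω) / (ζ + conj ω) := by
      field_simp; ring
    simp only [hm]
    rw [h3]
    field_simp
    ring
  rw [hF] at key
  simp only [hmz, norm_div] at key
  rwa [div_le_div_iff₀ (norm_pos_iff.2 (add_conj_ne_zero (hpos _ hζ) (hpos _ hω))) hnorm,
    mul_comm ‖ζ - ω‖] at key

/-- The Harnack inequality for the real part of a self-map of the right half-plane. -/
theorem harnack_rightHalfPlane {φ : ℂ → ℂ} (hd : DifferentiableOn ℂ φ rightHalfPlane)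
    (hpos : ∀ ζ ∈ rightHalfPlane, 0 < (φ ζ).re) {ζ ω : ℂ} (hζ : 0 < ζ.re) (hω : 0 < ω.re) :
    (φ ζ).re * (ζ.re * ω.re) ≤ (φ ω).re * ‖ζ + conj ω‖ ^ 2 := by
  have h := pow_le_pow_left₀ (by positivity) (schwarz_pick_rightHalfPlane hd hpos hζ hω) 2
  rw [mul_pow, mul_pow, normSq_sub_conj_identity, normSq_sub_conj_identity] at h
  have hU := hpos ζ hζ
  have hV := hpos ω hω
  have h2 : (φ ζ).re ^ 2 ≤ ‖φ ζ + conj (φ ω)‖ ^ 2 := by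
    refine pow_le_pow_left₀ hU.le ?_ 2
    refine le_trans ?_ (re_le_norm _)
    simp only [add_re, conj_re]; linarith
  have h3 : (φ ζ).re ^ 2 * (ζ.re * ω.re) ≤ ‖φ ζ + conj (φ ω)‖ ^ 2 * (ζ.re * ω.re) :=
    mul_le_mul_of_nonneg_right h2 (mul_pos hζ hω).le
  refine le_of_mul_le_mul_left ?_ hU
  nlinarith [h, h3]

/-- The growth estimate for a self-map of the right half-plane. -/
theorem norm_mul_re_le_of_re_pos {φ : ℂ → ℂ} (hd : DifferentiableOn ℂ φ rightHalfPlane)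
    (hpos : ∀ ζ ∈ rightHalfPlane, 0 < (φ ζ).re) {ζ : ℂ} (hζ : 0 < ζ.re) :
    ‖φ ζ‖ * ζ.re ≤ ‖φ 1‖ * ‖ζ + 1‖ ^ 2 := by
  have h := schwarz_pick_rightHalfPlane hd hpos hζ (ω := 1) (by simp)
  have e := normSq_sub_conj_identity ζ 1
  simp only [map_one, one_re, mul_one] at h e
  have h1 : ‖φ ζ‖ - ‖φ 1‖ ≤ ‖φ ζ - φ 1‖ := norm_sub_norm_le _ _
  have h2 : ‖φ ζ + conj (φ 1)‖ ≤ ‖φ ζ‖ + ‖φ 1‖ := by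
    simpa using norm_add_le (φ ζ) (conj (φ 1))
  have a0 := norm_nonneg (ζ + 1)
  have b0 := norm_nonneg (ζ - 1)
  have f0 := norm_nonneg (φ ζ)
  have g0 := norm_nonneg (φ 1)
  have hba : ‖ζ - 1‖ ≤ ‖ζ + 1‖ := by nlinarith
  have h3 := mul_le_mul_of_nonneg_right h1 a0
  have h4 := mul_le_mul_of_nonneg_right h2 b0
  have h5 : ‖φ ζ‖ * (‖ζ + 1‖ - ‖ζ - 1‖) ≤ ‖φ 1‖ * (‖ζ + 1‖ + ‖ζ - 1‖) := by linarith
  have h6 := mul_le_mul_of_nonneg_right h5 (add_nonneg a0 b0)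
  have h7 : ‖φ ζ‖ * (4 * ζ.re) ≤ ‖φ 1‖ * (‖ζ + 1‖ + ‖ζ - 1‖) ^ 2 := by
    have : 4 * ζ.re = (‖ζ + 1‖ - ‖ζ - 1‖) * (‖ζ + 1‖ + ‖ζ - 1‖) := by linarith
    rw [this]; linarith
  have h8 : ‖φ 1‖ * (‖ζ + 1‖ + ‖ζ - 1‖) ^ 2 ≤ ‖φ 1‖ * (2 * ‖ζ + 1‖) ^ 2 := by
    gcongr; linarith
  linarith

/-! ### Limits at the origin in sectors. -/

/-- The part of the sector `|Im ζ| ≤ M Re ζ` that lies in the strip `0 < Re ζ ≤ 1`. -/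
def truncatedSector (M : ℝ) : Set ℂ := {ζ | 0 < ζ.re ∧ ζ.re ≤ 1 ∧ |ζ.im| ≤ M * ζ.re}

lemma convex_truncatedSector (M : ℝ) : Convex ℝ (truncatedSector M) := by
  intro u hu v hv a b ha hb hab
  obtain ⟨h1, h2, h3⟩ := hu
  obtain ⟨k1, k2, k3⟩ := hv
  rw [abs_le] at h3 k3
  have hre : (a • u + b • v).re = a * u.re + b * v.re := by simp
  have him : (a • u + b • v).im = a * u.im + b * v.im := by simp
  refine ⟨?_, ?_, ?_⟩
  · rw [hre]
    rcases ha.eq_or_lt with h | h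
    · have : b = 1 := by linarith
      simp [← h, this, k1]
    · have := mul_pos h h1
      have := mul_nonneg hb k1.le
      linarith
  · rw [hre]
    nlinarith
  · rw [hre, him, abs_le]
    constructor <;> nlinarith

/-- If `T'(ζ) = e ζ P(ζ)` with `Re P > 0` in the right half-plane, then `Re T` has a limit at the
origin in every sector, with a linear rate. -/
theorem exists_sectorial_limit {T P : ℂ → ℂ} {e : ℂ}
    (hT : ∀ ζ ∈ rightHalfPlane, HasDerivAt T (e * (ζ * P ζ)) ζ)
    (hP : DifferentiableOn ℂ P rightHalfPlane) (hpos : ∀ ζ ∈ rightHalfPlane, 0 < (P ζ).re)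
    {M : ℝ} (hM : 0 ≤ M) :
    ∃ a B : ℝ, 0 ≤ B ∧ ∀ ζ ∈ truncatedSector M, |(T ζ).re - a| ≤ B * ‖ζ‖ := by
  set C : ℝ := ‖e‖ * ((1 + M) * (‖P 1‖ * (2 + M) ^ 2)) with hC
  have hC0 : 0 ≤ C := by positivity
  -- P grows at most like 1/Re ζ here, and |ζ| is comparable to Re ζ, so T' is bounded.
  have hbound : ∀ ζ ∈ truncatedSector M, ‖e * (ζ * P ζ)‖ ≤ C := by
    rintro ζ ⟨h1, h2, h3⟩
    have n1 : ‖ζ‖ ≤ (1 + M) * ζ.re := by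
      have := norm_le_abs_re_add_abs_im ζ
      rw [abs_of_pos h1] at this
      linarith
    have n2 : ‖ζ + 1‖ ≤ 2 + M := by
      have := norm_add_le ζ 1
      rw [norm_one] at this
      nlinarith
    rw [norm_mul, norm_mul, hC]
    refine mul_le_mul_of_nonneg_left ?_ (norm_nonneg e)
    calc ‖ζ‖ * ‖P ζ‖ ≤ (1 + M) * ζ.re * ‖P ζ‖ := by gcongr
      _ = (1 + M) * (‖P ζ‖ * ζ.re) := by ring
      _ ≤ (1 + M) * (‖P 1‖ * ‖ζ + 1‖ ^ 2) := by
        exact mul_le_mul_of_nonneg_left (norm_mul_re_le_of_re_pos hP hpos h1) (by positivity)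
      _ ≤ _ := by gcongr
  have hlip : LipschitzOnWith C.toNNReal (fun ζ => (T ζ).re) (truncatedSector M) := by
    refine LipschitzOnWith.of_dist_le_mul fun u hu v hv => ?_
    rw [Real.coe_toNNReal _ hC0, Real.dist_eq, ← sub_re, dist_eq_norm]
    refine (abs_re_le_norm _).trans ?_
    exact (convex_truncatedSector M).norm_image_sub_le_of_norm_hasDerivWithin_le
      (fun x hx => (hT x hx.1).hasDerivWithinAt) hbound hv hu
  -- The limit a is the value at 0 of a Lipschitz extension of Re T.
  obtain ⟨G, hG, hGeq⟩ := hlip.extend_real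
  refine ⟨G 0, C, hC0, fun ζ hζ => ?_⟩
  have := hG.dist_le_mul ζ 0
  rwa [Real.coe_toNNReal _ hC0, Real.dist_eq, ← hGeq hζ, dist_zero_right] at this

/-! ### The square-root coordinate and control near the imaginary axis. -/

/-- The square root with positive real part. -/
noncomputable def slitSqrt (z : ℂ) : ℂ := exp (log z / 2)

lemma slitSqrt_sq {z : ℂ} (hz : z ∈ slitPlane) : slitSqrt z ^ 2 = z := by
  rw [slitSqrt, ← exp_nat_mul]
  push_cast
  rw [mul_div_cancel₀ _ two_ne_zero, exp_log (slitPlane_ne_zero hz)]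

lemma slitSqrt_re_pos {z : ℂ} (hz : z ∈ slitPlane) : 0 < (slitSqrt z).re := by
  rw [slitSqrt, exp_re]
  refine mul_pos (Real.exp_pos _) (Real.cos_pos_of_mem_Ioo ?_)
  have h : (log z / 2).im = arg z / 2 := by
    rw [show (2 : ℂ) = ((2 : ℝ) : ℂ) by norm_num, div_ofReal_im, log_im]
  rw [h]
  have h1 := neg_pi_lt_arg z
  have h2 := (arg_le_pi z).lt_of_ne (mem_slitPlane_iff_arg.1 hz).1
  constructor <;> linarith

lemma eq_of_sq_eq_sq_of_re_pos {u v : ℂ} (hu : 0 < u.re) (hv : 0 < v.re) (h : u ^ 2 = v ^ 2) :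
    u = v := by
  rcases sq_eq_sq_iff_eq_or_eq_neg.1 h with h | h
  · exact h
  · have := congrArg re h
    simp at this
    linarith

lemma differentiableAt_slitSqrt {z : ℂ} (hz : z ∈ slitPlane) :
    DifferentiableAt ℂ slitSqrt z :=
  ((differentiableAt_log hz).div_const 2).cexp

lemma hasDerivAt_slitSqrt {z : ℂ} (hz : z ∈ slitPlane) :
    HasDerivAt slitSqrt (1 / (2 * slitSqrt z)) z := by
  have h1 : HasDerivAt slitSqrt (exp (log z / 2) * (z⁻¹ / 2)) z :=
    ((hasDerivAt_log hz).div_const 2).cexp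
  convert h1 using 1
  have h2 := slitSqrt_sq hz
  have h3 : slitSqrt z ≠ 0 := exp_ne_zero _
  change _ = slitSqrt z * (z⁻¹ / 2)
  have h4 : z⁻¹ = (slitSqrt z ^ 2)⁻¹ := by rw [h2]
  rw [h4]
  field_simp

lemma norm_slitSqrt_sq {z : ℂ} (hz : z ∈ slitPlane) : ‖slitSqrt z‖ ^ 2 = ‖z‖ := by
  rw [← norm_pow, slitSqrt_sq hz]

/-- The root lies in the sector |arg| < π/4, so its real part is comparable to √|z|. This makes it a
barrier in the Phragmén–Lindelöf argument. -/
lemma norm_le_two_mul_re_slitSqrt_sq {z : ℂ} (hz : 0 < z.re) :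
    ‖z‖ ≤ 2 * (slitSqrt z).re ^ 2 := by
  have hs : z ∈ slitPlane := Or.inl hz
  have h1 := norm_slitSqrt_sq hs
  have h2 := congrArg re (slitSqrt_sq hs)
  rw [← normSq_eq_norm_sq, normSq_apply] at h1
  rw [sq, mul_re] at h2
  nlinarith

/-- In the square-root coordinate, a horizontal line off the real axis shows that `Re R` is bounded
by its values on the diagonals. -/
lemma re_le_re_diagonal {R P : ℂ → ℂ}
    (hR : ∀ ζ ∈ rightHalfPlane, HasDerivAt R (ζ * P ζ) ζ)
    (hpos : ∀ ζ ∈ rightHalfPlane, 0 < (P ζ).re) {ζ : ℂ} (hζ : 0 < ζ.re) (h : ζ.re < |ζ.im|) :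
    ∃ ω : ℂ, 0 < ω.re ∧ |ω.im| = ω.re ∧ ω.re ^ 2 = ζ.re * |ζ.im| ∧ (R ζ).re ≤ (R ω).re := by
  set v : ℝ := 2 * ζ.re * ζ.im with hv
  have him : ζ.im ≠ 0 := by
    intro h0; rw [h0, abs_zero] at h; linarith
  have hv0 : v ≠ 0 := by positivity
  have hslit : ∀ u : ℝ, (u : ℂ) + v * I ∈ slitPlane := fun u => Or.inr (by simpa using hv0)
  -- With w = ζ², dR/dw = ζP/(2ζ) = P/2; the line is Im w = v.
  have hder : ∀ u : ℝ, HasDerivAt (fun u : ℝ => (R (slitSqrt ((u : ℂ) + v * I))).re)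
      ((P (slitSqrt ((u : ℂ) + v * I)) / 2).re) u := by
    intro u
    have h1 : HasDerivAt (fun w : ℂ => slitSqrt (w + v * I))
        (1 / (2 * slitSqrt ((u : ℂ) + v * I))) (u : ℂ) := by
      simpa using (hasDerivAt_slitSqrt (hslit u)).comp_add_const (u : ℂ) (v * I)
    have h2 := (hR _ (slitSqrt_re_pos (hslit u))).comp (u : ℂ) h1
    have h3 := HasDerivAt.real_of_complex h2
    have h4 : slitSqrt ((u : ℂ) + v * I) ≠ 0 := exp_ne_zero _
    convert h3 using 1
    congr 1
    rw [eq_comm, mul_one_div, mul_comm, mul_div_mul_right _ _ h4]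
  have hmono : Monotone (fun u : ℝ => (R (slitSqrt ((u : ℂ) + v * I))).re) := by
    refine monotone_of_deriv_nonneg (fun u => (hder u).differentiableAt) fun u => ?_
    rw [(hder u).deriv]
    have := hpos _ (slitSqrt_re_pos (hslit u))
    rw [show (2 : ℂ) = ((2 : ℝ) : ℂ) by norm_num, div_ofReal_re]
    positivity
  have hle : ζ.re ^ 2 - ζ.im ^ 2 ≤ 0 := by
    have := pow_le_pow_left₀ hζ.le h.le 2
    rw [sq_abs] at this
    linarith
  have hsq : ((ζ.re ^ 2 - ζ.im ^ 2 : ℝ) : ℂ) + v * I = ζ ^ 2 := by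
    apply Complex.ext <;> simp [sq, hv] ; ring
  have hζeq : slitSqrt (((ζ.re ^ 2 - ζ.im ^ 2 : ℝ) : ℂ) + v * I) = ζ :=
    eq_of_sq_eq_sq_of_re_pos (slitSqrt_re_pos (hslit _)) hζ (by rw [slitSqrt_sq (hslit _), hsq])
  have hcmp := hmono hle
  simp only [hζeq] at hcmp
  -- The point of the line with Re w = 0, hence on a diagonal.
  set ω := slitSqrt (((0 : ℝ) : ℂ) + v * I) with hω
  have hωpos : 0 < ω.re := slitSqrt_re_pos (hslit 0)
  have hω2 : ω ^ 2 = ((0 : ℝ) : ℂ) + v * I := slitSqrt_sq (hslit 0)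
  have hωre := congrArg re hω2
  have hωim := congrArg im hω2
  simp [sq] at hωre hωim
  have habs : |ω.im| = ω.re := by
    rw [← abs_of_pos hωpos, abs_eq_abs, ← mul_self_eq_mul_self_iff]
    linarith
  refine ⟨ω, hωpos, habs, ?_, hcmp⟩
  have h5 : 2 * ω.re * |ω.im| = 2 * ζ.re * |ζ.im| := by
    have : ω.re * ω.im = ζ.re * ζ.im := by rw [hv] at hωim; linarith
    have := congrArg abs this
    rw [abs_mul, abs_mul, abs_of_pos hωpos, abs_of_pos hζ] at this
    linarith
  rw [habs] at h5
  linarith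

/-- A function with positive real part that increases along the horizontal lines in the square-root
coordinate and is small at the origin in a sector is controlled near the imaginary axis. -/
theorem exists_re_le_sqrt {R P : ℂ → ℂ}
    (hR : ∀ ζ ∈ rightHalfPlane, HasDerivAt R (ζ * P ζ) ζ)
    (hP : ∀ ζ ∈ rightHalfPlane, 0 < (P ζ).re) (hpos : ∀ ζ ∈ rightHalfPlane, 0 < (R ζ).re)
    {B : ℝ} (hB : 0 ≤ B) (hlim : ∀ ζ ∈ truncatedSector 1, (R ζ).re ≤ B * ‖ζ‖) :
    ∃ A : ℝ, 0 ≤ A ∧ ∀ ζ ∈ rightHalfPlane, (R ζ).re ≤ A * √(ζ.re * ‖ζ‖) := by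
  have hd : DifferentiableOn ℂ R rightHalfPlane :=
    fun ζ hζ => (hR ζ hζ).differentiableAt.differentiableWithinAt
  have h1pos : 0 < (R 1).re := hpos 1 (by simp [rightHalfPlane])
  -- For Re ζ ≤ 1 the sector bound gives 2B; beyond, Harnack from the point 1 and |ζ+1|² ≤ 5(Re ζ)²
  -- give the other term.
  set A := 2 * B + 5 * (R 1).re with hA
  have hsector : ∀ ζ : ℂ, 0 < ζ.re → |ζ.im| ≤ ζ.re → (R ζ).re ≤ A * ζ.re := by
    intro ζ h0 hy
    rcases le_or_gt ζ.re 1 with h1 | h1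
    · have h2 := hlim ζ ⟨h0, h1, by simpa using hy⟩
      have h3 : ‖ζ‖ ≤ 2 * ζ.re := by
        have := norm_le_abs_re_add_abs_im ζ
        rw [abs_of_pos h0] at this
        linarith
      have h4 := mul_le_mul_of_nonneg_left h3 hB
      have h5 := mul_pos h1pos h0
      rw [hA]; linarith
    · have h2 := harnack_rightHalfPlane hd hpos h0 (ω := 1) (by simp)
      have h3 : ‖ζ + conj 1‖ ^ 2 ≤ 5 * ζ.re ^ 2 := by
        rw [← normSq_eq_norm_sq, normSq_apply]
        have := pow_le_pow_left₀ (abs_nonneg _) hy 2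
        rw [sq_abs] at this
        simp
        nlinarith
      have h4 := mul_le_mul_of_nonneg_left h3 h1pos.le
      have h5 : (R ζ).re * ζ.re ≤ (5 * (R 1).re * ζ.re) * ζ.re := by
        simp only [one_re, mul_one] at h2
        linarith
      have h6 := le_of_mul_le_mul_right h5 h0
      have h7 := mul_nonneg hB h0.le
      rw [hA]; linarith
  have hA0 : 0 ≤ A := by positivity
  refine ⟨A, hA0, fun ζ hζ => ?_⟩
  have hζ' : 0 < ζ.re := hζ
  rcases le_or_gt |ζ.im| ζ.re with h | h
  · refine (hsector ζ hζ h).trans (mul_le_mul_of_nonneg_left (Real.le_sqrt_of_sq_le ?_) hA0)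
    rw [sq]
    exact mul_le_mul_of_nonneg_left (re_le_norm ζ) hζ'.le
  · obtain ⟨ω, h1, h2, h3, h4⟩ := re_le_re_diagonal hR hP hζ h
    refine h4.trans ((hsector ω h1 h2.le).trans
      (mul_le_mul_of_nonneg_left (Real.le_sqrt_of_sq_le ?_) hA0))
    rw [h3]
    exact mul_le_mul_of_nonneg_left (abs_im_le_norm ζ) hζ'.le

/-! ### Phragmén–Lindelöf rigidity. -/

/-- A Phragmén–Lindelöf argument: a function with positive real part in the right half-plane that
is small near the imaginary axis has real part proportional to `Re ζ`. -/
theorem re_mul_re_le_of_le_sqrt {R : ℂ → ℂ} (hd : DifferentiableOn ℂ R rightHalfPlane)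
    (hpos : ∀ ζ ∈ rightHalfPlane, 0 < (R ζ).re) {A : ℝ} (hA : 0 ≤ A)
    (hle : ∀ ζ ∈ rightHalfPlane, (R ζ).re ≤ A * √(ζ.re * ‖ζ‖)) {ζ ω : ℂ}
    (hζ : 0 < ζ.re) (hω : 0 < ω.re) :
    (R ζ).re ≤ (R ω).re / ω.re * ζ.re := by
  set τ := (R ω).re / ω.re with hτ
  have hτ0 : 0 < τ := div_pos (hpos ω hω) hω
  have hRd : ∀ z : ℂ, 0 < z.re → DifferentiableAt ℂ R z := fun z hz =>
    (hd z hz).differentiableAt (isOpen_rightHalfPlane.mem_nhds hz)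
  -- Shifting by ε gives regularity up to the boundary; the error term vanishes as ε → 0.
  have hshift : ∀ ε : ℝ, 0 < ε →
      (R (ζ + ε)).re ≤ τ * ζ.re + A * √(2 * ε) * √‖ζ + ε‖ := by
    intro ε hε
    set K := A * √(2 * ε) with hK
    have hK0 : 0 ≤ K := by positivity
    -- The term τz absorbs the growth on the real axis; the root term makes Re q ≤ 0 on the
    -- imaginary axis.
    set q : ℂ → ℂ := fun z => R (z + ε) - τ * z - K * slitSqrt (z + ε) with hq
    have hqre : ∀ z, (q z).re = (R (z + ε)).re - τ * z.re - K * (slitSqrt (z + ε)).re := by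
      intro z; simp [hq]
    have hpos' : ∀ z : ℂ, 0 ≤ z.re → 0 < (z + ε).re := by
      intro z hz; simp; linarith
    have hqd : ∀ z : ℂ, 0 ≤ z.re → DifferentiableAt ℂ q z := by
      intro z hz
      have h1 : DifferentiableAt ℂ (fun z : ℂ => R (z + ε)) z :=
        (hRd _ (hpos' z hz)).comp z (by fun_prop : DifferentiableAt ℂ (fun z : ℂ => z + ε) z)
      have h2 : DifferentiableAt ℂ (fun z : ℂ => slitSqrt (z + ε)) z :=
        DifferentiableAt.comp (g := slitSqrt) (f := fun z : ℂ => z + ε) z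
          (differentiableAt_slitSqrt (Or.inl (hpos' z hz)))
          (by fun_prop : DifferentiableAt ℂ (fun z : ℂ => z + ε) z)
      exact (h1.sub (by fun_prop)).sub (h2.const_mul _)
    have hqle : ∀ z : ℂ, 0 ≤ z.re → (q z).re ≤ (R (z + ε)).re := by
      intro z hz
      rw [hqre]
      have h1 := mul_nonneg hτ0.le hz
      have h2 := mul_nonneg hK0 (slitSqrt_re_pos (Or.inl (hpos' z hz))).le
      linarith
    have hPL : ‖exp (q ζ)‖ ≤ 1 := by
      refine PhragmenLindelof.right_half_plane_of_bounded_on_real (f := fun z => exp (q z))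
        ?_ ⟨1, by norm_num, A, ?_⟩ ?_ ?_ hζ.le
      · refine DifferentiableOn.diffContOnCl ?_
        rw [Complex.closure_setOfPred_lt_re]
        exact fun z hz => (hqd z hz).cexp.differentiableWithinAt
      · refine Asymptotics.IsBigO.of_bound (Real.exp (A * ε)) ?_
        refine Filter.eventually_inf_principal.2 (Filter.Eventually.of_forall fun z hz => ?_)
        have hz' : 0 < z.re := hz
        have h0 := hpos' z hz'.le
        rw [norm_exp, Real.norm_eq_abs, Real.abs_exp, ← Real.exp_add, Real.exp_le_exp,
          Real.rpow_one]
        refine (hqle z hz'.le).trans ((hle _ h0).trans ?_)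
        have h1 : √((z + ε).re * ‖z + ε‖) ≤ ‖z + ε‖ := by
          rw [Real.sqrt_le_left (norm_nonneg _), sq]
          exact mul_le_mul_of_nonneg_right (re_le_norm _) (norm_nonneg _)
        have h2 : ‖z + ε‖ ≤ ‖z‖ + ε := by
          refine (norm_add_le _ _).trans ?_
          rw [norm_real, Real.norm_of_nonneg hε.le]
        have h3 := mul_le_mul_of_nonneg_left (h1.trans h2) hA
        linarith
      -- Harnack against ω bounds Re R(X) by τ(X + 2 Re ω + |ω|²/X), where X = x + ε.
      · refine Filter.isBoundedUnder_of_eventually_le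
          (a := Real.exp (τ * (ε + 2 * ω.re + ‖ω‖ ^ 2 / ε))) ?_
        filter_upwards [Filter.eventually_ge_atTop (0 : ℝ)] with x hx
        have h0 := hpos' (x : ℂ) (by simpa using hx)
        rw [norm_exp, Real.exp_le_exp, hqre]
        have h1 := harnack_rightHalfPlane hd hpos h0 hω
        have hre : ((x : ℂ) + ε).re = x + ε := by simp
        have h2 : ‖(x : ℂ) + ε + conj ω‖ ^ 2 = (x + ε) ^ 2 + 2 * (x + ε) * ω.re + ‖ω‖ ^ 2 := by
          rw [← normSq_eq_norm_sq, ← normSq_eq_norm_sq, normSq_apply, normSq_apply]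
          simp
          ring
        rw [h2, hre] at h1
        have hX : 0 < x + ε := by linarith
        have hXne := hX.ne'
        have h3 : (R (x + ε)).re ≤ τ * (x + ε + 2 * ω.re + ‖ω‖ ^ 2 / (x + ε)) := by
          refine le_of_mul_le_mul_right (h1.trans_eq ?_) (mul_pos hX hω)
          rw [hτ]
          field_simp
        have h4 : ‖ω‖ ^ 2 / (x + ε) ≤ ‖ω‖ ^ 2 / ε := by
          gcongr; linarith
        have h5 := mul_le_mul_of_nonneg_left h4 hτ0.le
        have h6 := mul_nonneg hK0 (slitSqrt_re_pos (Or.inl h0)).le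
        simp only [ofReal_re]
        linarith
      · intro y
        have hre : ((y : ℂ) * I).re = 0 := by simp
        have h0 := hpos' ((y : ℂ) * I) hre.ge
        rw [norm_exp, Real.exp_le_one_iff, hqre, hre, mul_zero, sub_zero, sub_nonpos]
        refine (hle _ h0).trans ?_
        rw [hK, mul_assoc]
        refine mul_le_mul_of_nonneg_left ?_ hA
        have h1 : ((y : ℂ) * I + ε).re = ε := by simp
        rw [h1, ← Real.sqrt_sq (slitSqrt_re_pos (Or.inl h0)).le, ← Real.sqrt_mul (by positivity)]
        refine Real.sqrt_le_sqrt ?_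
        have h2 := norm_le_two_mul_re_slitSqrt_sq h0
        nlinarith
    rw [norm_exp, Real.exp_le_one_iff, hqre] at hPL
    have h1 : (slitSqrt (ζ + ε)).re ≤ √‖ζ + ε‖ := by
      rw [← norm_slitSqrt_sq (Or.inl (hpos' ζ hζ.le)), Real.sqrt_sq (norm_nonneg _)]
      exact re_le_norm _
    have h2 := mul_le_mul_of_nonneg_left h1 hK0
    linarith
  have hl : Filter.Tendsto (fun ε : ℝ => (R (ζ + ε)).re) (nhdsWithin 0 (Ioi 0))
      (nhds (R ζ).re) := by
    have h1 : ContinuousAt (fun ε : ℝ => (R (ζ + ε)).re) 0 := by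
      refine continuous_re.continuousAt.comp ?_
      refine ContinuousAt.comp (g := R) (f := fun ε : ℝ => ζ + (ε : ℂ)) ?_ (by fun_prop)
      simpa using (hRd ζ hζ).continuousAt
    simpa using h1.tendsto.mono_left nhdsWithin_le_nhds
  have hr : Filter.Tendsto (fun ε : ℝ => τ * ζ.re + A * √(2 * ε) * √‖ζ + ε‖)
      (nhdsWithin 0 (Ioi 0)) (nhds (τ * ζ.re)) := by
    have h1 : ContinuousAt (fun ε : ℝ => τ * ζ.re + A * √(2 * ε) * √‖ζ + ε‖) 0 := by
      fun_prop
    simpa using h1.tendsto.mono_left nhdsWithin_le_nhds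
  exact le_of_tendsto_of_tendsto hl hr
    (by filter_upwards [self_mem_nhdsWithin] with ε hε using hshift ε hε)

/-- A holomorphic function whose real part is `C Re ζ` in the right half-plane has derivative
`C`. -/
lemma deriv_eq_of_re_eq {R : ℂ → ℂ} {C : ℝ} {ζ d : ℂ}
    (hre : ∀ z ∈ rightHalfPlane, (R z).re = C * z.re) (hζ : ζ ∈ rightHalfPlane)
    (hd : HasDerivAt R d ζ) : d = C := by
  have h1 : HasFDerivAt (fun z => (R z).re) _ ζ :=
    reCLM.hasFDerivAt.comp ζ (hd.hasFDerivAt.restrictScalars ℝ)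
  have h2 : HasFDerivAt (fun z : ℂ => (R z).re) (C • reCLM) ζ := by
    refine (reCLM.hasFDerivAt.const_smul C).congr_of_eventuallyEq ?_
    filter_upwards [isOpen_rightHalfPlane.mem_nhds hζ] with z hz
    simpa using hre z hz
  have h3 := h1.unique h2
  have e1 := DFunLike.congr_fun h3 1
  have e2 := DFunLike.congr_fun h3 I
  simp at e1 e2
  apply Complex.ext <;> simp [e1, e2]

/-- If `R` and `R'(ζ) / ζ` have positive real part in the right half-plane and `Re R` vanishes at
the origin in a sector, then `R'` is a real constant. -/
theorem exists_real_deriv_eq {R P : ℂ → ℂ}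
    (hR : ∀ ζ ∈ rightHalfPlane, HasDerivAt R (ζ * P ζ) ζ)
    (hP : ∀ ζ ∈ rightHalfPlane, 0 < (P ζ).re) (hpos : ∀ ζ ∈ rightHalfPlane, 0 < (R ζ).re)
    {B : ℝ} (hB : 0 ≤ B) (hlim : ∀ ζ ∈ truncatedSector 1, (R ζ).re ≤ B * ‖ζ‖) :
    ∃ C : ℝ, ∀ ζ ∈ rightHalfPlane, ζ * P ζ = C := by
  have hd : DifferentiableOn ℂ R rightHalfPlane :=
    fun ζ hζ => (hR ζ hζ).differentiableAt.differentiableWithinAt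
  obtain ⟨A, hA, hle⟩ := exists_re_le_sqrt hR hP hpos hB hlim
  refine ⟨(R 1).re, fun ζ hζ => deriv_eq_of_re_eq (fun z hz => le_antisymm ?_ ?_) hζ (hR ζ hζ)⟩
  · simpa using re_mul_re_le_of_le_sqrt hd hpos hA hle hz (ω := 1) (by simp)
  · have hz' : 0 < z.re := hz
    have := re_mul_re_le_of_le_sqrt hd hpos hA hle (ζ := 1) (by simp) hz
    rw [one_re, mul_one, le_div_iff₀ hz'] at this
    exact this

/-! ### Consequences of convexity: the omitted value. -/

/-- Strict monotonicity of `Re T` along a ray on which `e ζ ^ 2` is real. -/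
lemma lt_re_on_ray {T P : ℂ → ℂ} {e s : ℂ} {σ a B M t : ℝ}
    (hT : ∀ ζ ∈ rightHalfPlane, HasDerivAt T (e * (ζ * P ζ)) ζ)
    (hpos : ∀ ζ ∈ rightHalfPlane, 0 < (P ζ).re)
    (hlim : ∀ ζ ∈ truncatedSector M, |(T ζ).re - a| ≤ B * ‖ζ‖)
    (hs : 0 < s.re) (hsM : |s.im| ≤ M * s.re) (hes : e * s ^ 2 = σ) (hσ : σ ≠ 0) (ht : 0 < t) :
    σ * a < σ * (T (t * s)).re := by
  have hray : ∀ r : ℝ, 0 < r → (r * s : ℂ) ∈ rightHalfPlane := fun r hr => by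
    simpa [rightHalfPlane] using mul_pos hr hs
  have hder : ∀ r : ℝ, 0 < r → HasDerivAt (fun r : ℝ => σ * (T (r * s)).re)
      (σ ^ 2 * (r * (P (r * s)).re)) r := by
    intro r hr
    have h1 : HasDerivAt (fun w : ℂ => w * s) s (r : ℂ) := by
      simpa using (hasDerivAt_id (r : ℂ)).mul_const s
    have h2 := ((hT _ (hray r hr)).comp (r : ℂ) h1).real_of_complex.const_mul σ
    refine h2.congr_deriv ?_
    have h3 : e * (r * s * P (r * s)) * s = ((σ * r : ℝ) : ℂ) * P (r * s) := by
      push_cast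
      rw [← hes]
      ring
    rw [h3, re_ofReal_mul]
    ring
  have hmono : StrictMonoOn (fun r : ℝ => σ * (T (r * s)).re) (Ioi 0) := by
    refine strictMonoOn_of_deriv_pos (convex_Ioi 0)
      (fun r hr => (hder r hr).continuousAt.continuousWithinAt) fun r hr => ?_
    rw [interior_Ioi] at hr
    rw [(hder r hr).deriv]
    have h1 := hpos _ (hray r hr)
    have h2 : 0 < r := hr
    positivity
  -- The limit at 0 only gives a weak inequality, at t/2; strictness comes from passing on to t.
  have ht2 : 0 < t / 2 := by linarith
  refine lt_of_le_of_lt ?_ (hmono (mem_Ioi.2 ht2) (mem_Ioi.2 ht) (by linarith))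
  have htend : Filter.Tendsto (fun r : ℝ => σ * a - |σ| * (B * (r * ‖s‖)))
      (nhdsWithin 0 (Ioi 0)) (nhds (σ * a)) := by
    have h1 : ContinuousAt (fun r : ℝ => σ * a - |σ| * (B * (r * ‖s‖))) 0 := by fun_prop
    simpa using h1.tendsto.mono_left nhdsWithin_le_nhds
  refine le_of_tendsto htend ?_
  have hev : ∀ᶠ r : ℝ in nhdsWithin 0 (Ioi 0), r ∈ Ioo 0 (min (t / 2) (1 / s.re)) :=
    Ioo_mem_nhdsGT (by positivity)
  filter_upwards [hev] with r hr
  obtain ⟨hr0, hr1⟩ := hr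
  have h2 : r < t / 2 := hr1.trans_le (min_le_left _ _)
  have h3 : r * s.re ≤ 1 := by
    rw [← le_div_iff₀ hs]
    exact hr1.le.trans (min_le_right _ _)
  refine le_trans ?_ (hmono (mem_Ioi.2 hr0) (mem_Ioi.2 ht2) h2).le
  have h4 : (r * s : ℂ) ∈ truncatedSector M := by
    refine ⟨hray r hr0, by simpa using h3, ?_⟩
    rw [re_ofReal_mul, im_ofReal_mul, abs_mul, abs_of_pos hr0]
    have := mul_le_mul_of_nonneg_left hsM hr0.le
    linarith
  have h5 := hlim _ h4
  rw [norm_mul, norm_real, Real.norm_of_nonneg hr0.le] at h5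
  have h6 : |σ * (T (r * s)).re - σ * a| ≤ |σ| * (B * (r * ‖s‖)) := by
    rw [← mul_sub, abs_mul]
    exact mul_le_mul_of_nonneg_left h5 (abs_nonneg _)
  have h7 := (abs_le.1 h6).1
  simp only
  linarith

/-- If the harmonic map with real part `Re T` and imaginary part `Im (b (ζ ^ 2 - 1) / 4)` has convex
image, then the slit of the image of `b (ζ ^ 2 - 1) / 4` is horizontal. -/
theorem im_eq_zero_of_convex {T P : ℂ → ℂ} {b : ℂ} (hb : ‖b‖ = 1)
    (hT : ∀ ζ ∈ rightHalfPlane, HasDerivAt T (b * (ζ * P ζ)) ζ)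
    (hP : DifferentiableOn ℂ P rightHalfPlane) (hpos : ∀ ζ ∈ rightHalfPlane, 0 < (P ζ).re)
    {Φ : ℂ → ℂ} (hre : ∀ ζ ∈ rightHalfPlane, (Φ ζ).re = (T ζ).re)
    (him : ∀ ζ ∈ rightHalfPlane, (Φ ζ).im = (b * ((ζ ^ 2 - 1) / 4)).im)
    (hconv : Convex ℝ (Φ '' rightHalfPlane)) : b.im = 0 := by
  by_contra hbim
  have hbb : b * conj b = 1 := by rw [mul_conj, normSq_eq_norm_sq, hb]; simp
  have hs1 : conj b ∈ slitPlane := Or.inr (by simpa using hbim)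
  have hs2 : -conj b ∈ slitPlane := Or.inr (by simpa using hbim)
  set s := slitSqrt (conj b) with hs
  set r := slitSqrt (-conj b) with hr
  have hs0 : 0 < s.re := slitSqrt_re_pos hs1
  have hr0 : 0 < r.re := slitSqrt_re_pos hs2
  have hsq : s ^ 2 = conj b := slitSqrt_sq hs1
  have hrq : r ^ 2 = -conj b := slitSqrt_sq hs2
  have hbs : b * s ^ 2 = ((1 : ℝ) : ℂ) := by rw [hsq, hbb]; simp
  have hbr : b * r ^ 2 = ((-1 : ℝ) : ℂ) := by rw [hrq, mul_neg, hbb]; simp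
  set M := max (|s.im| / s.re) (|r.im| / r.re) with hM
  have hMs : |s.im| ≤ M * s.re := by rw [← div_le_iff₀ hs0]; exact le_max_left _ _
  have hMr : |r.im| ≤ M * r.re := by rw [← div_le_iff₀ hr0]; exact le_max_right _ _
  have hM0 : 0 ≤ M := le_max_of_le_left (by positivity)
  obtain ⟨a, B, -, hlim⟩ := exists_sectorial_limit hT hP hpos hM0
  have hS : ∀ t : ℝ, 0 < t → a < (T (t * s)).re := fun t ht => by
    simpa using lt_re_on_ray hT hpos hlim hs0 hMs hbs one_ne_zero ht
  have hR : ∀ t : ℝ, 0 < t → (T (t * r)).re < a := fun t ht => by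
    simpa using lt_re_on_ray hT hpos hlim hr0 hMr hbr (by norm_num) ht
  have h1 := hS 1 one_pos
  have h2 := hR 1 one_pos
  simp only [ofReal_one, one_mul] at h1 h2
  have himf : ∀ ζ : ℂ, (b * ((ζ ^ 2 - 1) / 4)).im = ((b * ζ ^ 2).im - b.im) / 4 := by
    intro ζ
    rw [show b * ((ζ ^ 2 - 1) / 4) = (b * ζ ^ 2 - b) / ((4 : ℝ) : ℂ) by push_cast; ring,
      div_ofReal_im, sub_im]
  -- Φ r and Φ s lie at this height on opposite sides of a.
  have hmem : (⟨a, -b.im / 4⟩ : ℂ) ∈ Φ '' rightHalfPlane := by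
    refine hconv.segment_subset (mem_image_of_mem Φ hr0) (mem_image_of_mem Φ hs0) ?_
    refine ⟨((T s).re - a) / ((T s).re - (T r).re), (a - (T r).re) / ((T s).re - (T r).re),
      by apply div_nonneg <;> linarith, by apply div_nonneg <;> linarith, ?_, ?_⟩
    · have : (T s).re - (T r).re ≠ 0 := by linarith
      field_simp; ring
    · have hne : (T s).re - (T r).re ≠ 0 := by linarith
      apply Complex.ext
      · simp only [add_re, real_smul, re_ofReal_mul, hre r hr0, hre s hs0]
        field_simp; ring
      · simp only [add_im, real_smul, im_ofReal_mul, him r hr0, him s hs0, himf, hbs, hbr,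
          ofReal_im]
        field_simp; ring
  obtain ⟨ζ, hζ, hΦ⟩ := hmem
  have hζ0 : 0 < ζ.re := hζ
  have hre' : (T ζ).re = a := by rw [← hre ζ hζ, hΦ]
  have him' : (b * ζ ^ 2).im = 0 := by
    have := him ζ hζ
    rw [hΦ, himf] at this
    simp only at this
    linarith
  -- A preimage has bζ² real, so it lies on the ray of s or of r according to the sign of σ.
  set σ := (b * ζ ^ 2).re with hσ
  have hbζ : b * ζ ^ 2 = σ := Complex.ext rfl (by simpa using him')
  have hζsq : ζ ^ 2 = σ * conj b := by
    rw [← hbζ]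
    linear_combination (-ζ ^ 2) * hbb
  have hσ0 : σ ≠ 0 := by
    intro h
    rw [h, ofReal_zero, zero_mul, sq_eq_zero_iff] at hζsq
    simp [hζsq] at hζ0
  rcases hσ0.lt_or_gt with h | h
  · have ht : 0 < √(-σ) := Real.sqrt_pos.2 (by linarith)
    have : ζ = √(-σ) * r := by
      refine eq_of_sq_eq_sq_of_re_pos hζ0 (by simpa using mul_pos ht hr0) ?_
      rw [mul_pow, hrq, hζsq, ← ofReal_pow, Real.sq_sqrt (by linarith)]
      push_cast; ring
    have h3 := hR _ ht
    rw [← this] at h3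
    linarith
  · have ht : 0 < √σ := Real.sqrt_pos.2 h
    have : ζ = √σ * s := by
      refine eq_of_sq_eq_sq_of_re_pos hζ0 (by simpa using mul_pos ht hs0) ?_
      rw [mul_pow, hsq, hζsq, ← ofReal_pow, Real.sq_sqrt h.le]
    have h3 := hS _ ht
    rw [← this] at h3
    linarith

/-- The rigidity of the half-plane mapping: if the harmonic map with real part `Re T` and imaginary
part `Im ((ζ ^ 2 - 1) / 4)` has convex image, then `T` is affine. -/
theorem eq_affine_of_convex {T P : ℂ → ℂ}
    (hT : ∀ ζ ∈ rightHalfPlane, HasDerivAt T (ζ * P ζ) ζ)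
    (hP : DifferentiableOn ℂ P rightHalfPlane) (hpos : ∀ ζ ∈ rightHalfPlane, 0 < (P ζ).re)
    (hT1 : T 1 = 0) (hP1 : P 1 = 1 / 2)
    {Φ : ℂ → ℂ} (hre : ∀ ζ ∈ rightHalfPlane, (Φ ζ).re = (T ζ).re)
    (him : ∀ ζ ∈ rightHalfPlane, (Φ ζ).im = ((ζ ^ 2 - 1) / 4).im)
    (hopen : IsOpen (Φ '' rightHalfPlane)) (hconv : Convex ℝ (Φ '' rightHalfPlane)) :
    ∀ ζ ∈ rightHalfPlane, T ζ = (ζ - 1) / 2 := by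
  have h1mem : (1 : ℂ) ∈ rightHalfPlane := by simp [rightHalfPlane]
  have hTe : ∀ ζ ∈ rightHalfPlane, HasDerivAt T (1 * (ζ * P ζ)) ζ := by simpa using hT
  obtain ⟨a, B, hB, hlim⟩ := exists_sectorial_limit hTe hP hpos zero_le_one
  have hray : ∀ t : ℝ, 0 < t → a < (T t).re := fun t ht => by
    simpa using lt_re_on_ray hTe hpos hlim (s := 1) (σ := 1) (by simp) (by simp) (by simp)
      one_ne_zero ht
  have himf : ∀ ζ : ℂ, ((ζ ^ 2 - 1) / 4).im = ζ.re * ζ.im / 2 := by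
    intro ζ
    rw [show (4 : ℂ) = ((4 : ℝ) : ℂ) by norm_num, div_ofReal_im]
    simp [sq]; ring
  -- Height 0 is attained only on the positive reals, where Re T > a.
  have hnot : (a : ℂ) ∉ Φ '' rightHalfPlane := by
    rintro ⟨ζ, hζ, hΦ⟩
    have hζ0 : 0 < ζ.re := hζ
    have h1 := him ζ hζ
    rw [hΦ, himf, ofReal_im] at h1
    have h2 : ζ.im = 0 := by
      rcases mul_eq_zero.1 (by linarith : ζ.re * ζ.im = 0) with h | h
      · linarith
      · exact h
    have h3 : ζ = (ζ.re : ℂ) := Complex.ext (by simp) (by simpa using h2)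
    have h4 := hray _ hζ0
    rw [← h3, ← hre ζ hζ, hΦ, ofReal_re] at h4
    exact lt_irrefl _ h4
  obtain ⟨φ, hφ⟩ := geometric_hahn_banach_open_point hconv hopen hnot
  set α := φ 1 with hα
  set β := φ I with hβ
  have hφval : ∀ z : ℂ, φ z = α * z.re + β * z.im := by
    intro z
    conv_lhs => rw [show z = z.re • (1 : ℂ) + z.im • I by
      apply Complex.ext <;> simp]
    rw [map_add, map_smul, map_smul, smul_eq_mul, smul_eq_mul]
    ring
  have hφ' : ∀ ζ ∈ rightHalfPlane, α * (T ζ).re + β * ((ζ ^ 2 - 1) / 4).im < α * a := by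
    intro ζ hζ
    have := hφ _ (mem_image_of_mem Φ hζ)
    rw [hφval, hφval, hre ζ hζ, him ζ hζ] at this
    simpa using this
  have hα0 : α < 0 := by
    have h1 := hφ' 1 h1mem
    have h2 := hray 1 one_pos
    rw [himf] at h1
    simp at h1 h2
    nlinarith
  set κ := β / α with hκ
  -- Re R is the separating functional, relative to its value at a, divided by α < 0.
  set R : ℂ → ℂ := fun ζ => T ζ - κ * I * ((ζ ^ 2 - 1) / 4) - a with hR
  have hRre : ∀ ζ, (R ζ).re = (T ζ).re + κ * ((ζ ^ 2 - 1) / 4).im - a := by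
    intro ζ
    simp only [hR, sub_re, ofReal_re, mul_assoc, re_ofReal_mul, I_mul_re]
    ring
  have hRpos : ∀ ζ ∈ rightHalfPlane, 0 < (R ζ).re := by
    intro ζ hζ
    have h1 := hφ' ζ hζ
    have h2 : β = κ * α := (div_mul_cancel₀ β hα0.ne).symm
    rw [hRre]
    rw [h2] at h1
    nlinarith
  have hRder : ∀ ζ ∈ rightHalfPlane, HasDerivAt R (ζ * (P ζ - κ * I / 2)) ζ := by
    intro ζ hζ
    have h1 : HasDerivAt (fun ζ : ℂ => (ζ ^ 2 - 1) / 4) (2 * ζ / 4) ζ := by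
      simpa using (((hasDerivAt_id ζ).pow 2).sub_const 1).div_const 4
    have h2 := ((hT ζ hζ).sub (h1.const_mul (κ * I))).sub_const (a : ℂ)
    refine h2.congr_deriv ?_
    ring
  have hRP : ∀ ζ ∈ rightHalfPlane, 0 < (P ζ - κ * I / 2).re := by
    intro ζ hζ
    have h1 : (κ * I / 2 : ℂ).re = 0 := by
      rw [show (2 : ℂ) = ((2 : ℝ) : ℂ) by norm_num, div_ofReal_re]; simp
    rw [sub_re, h1, sub_zero]
    exact hpos ζ hζ
  have hRlim : ∀ ζ ∈ truncatedSector 1, (R ζ).re ≤ (B + |κ|) * ‖ζ‖ := by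
    intro ζ hζ
    have h1 := (abs_le.1 (hlim ζ hζ)).2
    have h2 : κ * (ζ.re * ζ.im / 2) ≤ |κ| * ‖ζ‖ := by
      refine (le_abs_self _).trans ?_
      rw [abs_mul]
      refine mul_le_mul_of_nonneg_left ?_ (abs_nonneg _)
      rw [abs_div, abs_mul, abs_of_pos hζ.1, abs_two]
      have h3 := abs_im_le_norm ζ
      have h4 := mul_le_mul_of_nonneg_right hζ.2.1 (abs_nonneg ζ.im)
      have := abs_nonneg ζ.im
      linarith
    rw [hRre, himf]
    linarith
  obtain ⟨C, hC⟩ := exists_real_deriv_eq hRder hRP hRpos (by positivity) hRlim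
  have hC1 := hC 1 h1mem
  rw [hP1] at hC1
  have hκ0 : κ = 0 := by
    have := congrArg im hC1
    rw [one_mul, sub_im, show (2 : ℂ) = ((2 : ℝ) : ℂ) by norm_num, div_ofReal_im] at this
    simpa using this
  have hζP : ∀ ζ ∈ rightHalfPlane, ζ * P ζ = 1 / 2 := by
    intro ζ hζ
    have := hC ζ hζ
    rw [← hC1, hκ0] at this
    simpa using this
  intro ζ hζ
  have hconvH : Convex ℝ rightHalfPlane := convex_halfSpace_re_gt 0
  have hD : ∀ z ∈ rightHalfPlane,
      HasDerivWithinAt (fun z => T z - (z - 1) / 2) 0 rightHalfPlane z := by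
    intro z hz
    have h1 := (hT z hz).sub (((hasDerivAt_id z).sub_const 1).div_const 2)
    rw [hζP z hz, sub_self] at h1
    exact h1.hasDerivWithinAt
  have := hconvH.norm_image_sub_le_of_norm_hasDerivWithin_le hD (C := 0) (by simp) h1mem hζ
  simpa [hT1, sub_eq_zero] using this

/-! ### Orientation, positive real part and the half-plane version. -/

/-- The determinant of the real-linear map `v ↦ α v + conj (β v)`. -/
lemma det_eq_normSq_sub_normSq (A : ℂ →L[ℝ] ℂ) (α β : ℂ)
    (hA : ∀ v, A v = α * v + conj (β * v)) : A.det = ‖α‖ ^ 2 - ‖β‖ ^ 2 := by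
  rw [ContinuousLinearMap.det, ← LinearMap.det_toMatrix basisOneI, Matrix.det_fin_two]
  simp only [LinearMap.toMatrix_apply, coe_basisOneI, coe_basisOneI_repr,
    ContinuousLinearMap.coe_coe, hA, ← normSq_eq_norm_sq, normSq_apply]
  simp
  ring

/-- An orientation-preserving harmonic map `h + conj g` satisfies `|g'| < |h'|`. -/
lemma norm_deriv_lt_of_orientationPreserving {f h g : ℂ → ℂ}
    (hh : DifferentiableOn ℂ h unitDisk) (hg : DifferentiableOn ℂ g unitDisk)
    (hf : ∀ z ∈ unitDisk, f z = h z + conj (g z)) (hop : OrientationPreserving f)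
    {z : ℂ} (hz : z ∈ unitDisk) : ‖deriv g z‖ < ‖deriv h z‖ := by
  have hnhds : unitDisk ∈ nhds z := isOpen_ball.mem_nhds hz
  have h1 := ((hh z hz).differentiableAt hnhds).hasDerivAt.hasFDerivAt.restrictScalars ℝ
  have h2 := ((hg z hz).differentiableAt hnhds).hasDerivAt.hasFDerivAt.restrictScalars ℝ
  have h3 := h1.add ((conjCLE : ℂ →L[ℝ] ℂ).hasFDerivAt.comp z h2)
  have h4 := h3.congr_of_eventuallyEq (f₁ := f)
    (by filter_upwards [hnhds] with w hw using by simpa using hf w hw)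
  have h5 := hop z hz
  rw [h4.fderiv, det_eq_normSq_sub_normSq _ (deriv h z) (deriv g z)
    (fun v => by simp [mul_comm])] at h5
  exact lt_of_pow_lt_pow_left₀ 2 (norm_nonneg _) (by linarith)

/-- With w = v/u this is half of (1+w)/(1-w), where |w| < 1. It turns the bound on the dilatation
into Re P > 0. -/
lemma re_add_div_sub_pos {u v : ℂ} (h : ‖v‖ < ‖u‖) : 0 < ((u + v) / (2 * (u - v))).re := by
  have hne : u - v ≠ 0 := by
    intro h0
    rw [sub_eq_zero] at h0
    simp [h0] at h
  have h1 : 0 < normSq (u - v) := normSq_pos.2 hne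
  have h2 := pow_lt_pow_left₀ h (norm_nonneg _) two_ne_zero
  rw [← normSq_eq_norm_sq, ← normSq_eq_norm_sq] at h2
  have : ((u + v) / (2 * (u - v))).re = (normSq u - normSq v) / (2 * normSq (u - v)) := by
    rw [div_re, normSq_mul]
    have h3 : normSq 2 = 4 := by simp; norm_num
    rw [h3]
    field_simp
    simp [normSq_apply]
    ring
  rw [this]
  exact div_pos (by linarith) (by linarith)

/-- The half-plane version of the theorem: `H + conj G` is a harmonic map with convex image whose
shear in the direction `b` is the Koebe function. -/
theorem eq_affine_of_shear_eq_koebe {H G : ℂ → ℂ} {b : ℂ} (hb : ‖b‖ = 1)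
    (hH : DifferentiableOn ℂ H rightHalfPlane) (hG : DifferentiableOn ℂ G rightHalfPlane)
    (hlt : ∀ ζ ∈ rightHalfPlane, ‖deriv G ζ‖ < ‖deriv H ζ‖)
    (hk : ∀ ζ ∈ rightHalfPlane, b * H ζ - conj b * G ζ = b * ((ζ ^ 2 - 1) / 4))
    (hH1 : H 1 = 0) (hG1 : G 1 = 0) (hdH1 : deriv H 1 = 1 / 2) (hdG1 : deriv G 1 = 0)
    (hopen : IsOpen ((fun ζ => H ζ + conj (G ζ)) '' rightHalfPlane))
    (hconv : Convex ℝ ((fun ζ => H ζ + conj (G ζ)) '' rightHalfPlane)) :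
    ∀ ζ ∈ rightHalfPlane, H ζ - G ζ = (ζ ^ 2 - 1) / 4 ∧ H ζ + G ζ = (ζ - 1) / 2 := by
  have hb0 : b ≠ 0 := norm_ne_zero_iff.1 (by rw [hb]; exact one_ne_zero)
  have hζ0 : ∀ ζ ∈ rightHalfPlane, ζ ≠ 0 := by
    rintro ζ hζ rfl
    exact lt_irrefl (0 : ℝ) hζ
  have hHd : ∀ ζ ∈ rightHalfPlane, HasDerivAt H (deriv H ζ) ζ := fun ζ hζ =>
    ((hH ζ hζ).differentiableAt (isOpen_rightHalfPlane.mem_nhds hζ)).hasDerivAt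
  have hGd : ∀ ζ ∈ rightHalfPlane, HasDerivAt G (deriv G ζ) ζ := fun ζ hζ =>
    ((hG ζ hζ).differentiableAt (isOpen_rightHalfPlane.mem_nhds hζ)).hasDerivAt
  have hkd : ∀ ζ ∈ rightHalfPlane, b * ζ = 2 * (b * deriv H ζ - conj b * deriv G ζ) := by
    intro ζ hζ
    have h1 := ((hHd ζ hζ).const_mul b).sub ((hGd ζ hζ).const_mul (conj b))
    have h2 : HasDerivAt (fun ζ : ℂ => b * ((ζ ^ 2 - 1) / 4)) (b * (2 * ζ / 4)) ζ := by
      simpa using ((((hasDerivAt_id ζ).pow 2).sub_const 1).div_const 4).const_mul b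
    have h3 := h1.unique (h2.congr_of_eventuallyEq (by
      filter_upwards [isOpen_rightHalfPlane.mem_nhds hζ] with z hz using hk z hz))
    rw [h3]; ring
  set P : ℂ → ℂ := fun ζ => (b * deriv H ζ + conj b * deriv G ζ) / (b * ζ) with hPdef
  have hP : DifferentiableOn ℂ P rightHalfPlane := by
    refine DifferentiableOn.div ?_ (by fun_prop) fun ζ hζ => mul_ne_zero hb0 (hζ0 ζ hζ)
    exact ((hH.deriv isOpen_rightHalfPlane).const_mul b).add
      ((hG.deriv isOpen_rightHalfPlane).const_mul (conj b))
  have hpos : ∀ ζ ∈ rightHalfPlane, 0 < (P ζ).re := by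
    intro ζ hζ
    simp only [hPdef, hkd ζ hζ]
    refine re_add_div_sub_pos ?_
    rw [norm_mul, norm_mul, norm_conj, hb, one_mul, one_mul]
    exact hlt ζ hζ
  have hT : ∀ ζ ∈ rightHalfPlane,
      HasDerivAt (fun ζ => b * H ζ + conj b * G ζ) (b * (ζ * P ζ)) ζ := by
    intro ζ hζ
    have h1 := ((hHd ζ hζ).const_mul b).add ((hGd ζ hζ).const_mul (conj b))
    refine h1.congr_deriv ?_
    have := hζ0 ζ hζ
    simp only [hPdef]
    field_simp
  have hbim : b.im = 0 := by
    refine im_eq_zero_of_convex hb hT hP hpos (Φ := fun ζ => b * (H ζ + conj (G ζ))) ?_ ?_ ?_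
    · intro ζ _
      simp
      ring
    · intro ζ hζ
      rw [← hk ζ hζ]
      simp
      ring
    · have : (fun ζ => b * (H ζ + conj (G ζ))) '' rightHalfPlane =
          LinearMap.mulLeft ℝ b '' ((fun ζ => H ζ + conj (G ζ)) '' rightHalfPlane) := by
        rw [image_image]; rfl
      rw [this]
      exact hconv.linear_image _
  -- A real unimodular b is ±1, so it cancels from the shear.
  have hconj : conj b = b := conj_eq_iff_im.2 hbim
  rw [hconj] at hk hT
  have hsub : ∀ ζ ∈ rightHalfPlane, H ζ - G ζ = (ζ ^ 2 - 1) / 4 := fun ζ hζ =>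
    mul_left_cancel₀ hb0 (by rw [mul_sub]; exact hk ζ hζ)
  have hT' : ∀ ζ ∈ rightHalfPlane, HasDerivAt (fun ζ => H ζ + G ζ) (ζ * P ζ) ζ := by
    intro ζ hζ
    refine ((hHd ζ hζ).add (hGd ζ hζ)).congr_deriv ?_
    have := hζ0 ζ hζ
    simp only [hPdef, hconj]
    field_simp
  have hadd := eq_affine_of_convex hT' hP hpos (by simp [hH1, hG1])
    (by simp only [hPdef, hdH1, hdG1]; field_simp; simp)
    (Φ := fun ζ => H ζ + conj (G ζ)) (fun ζ _ => by simp)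
    (fun ζ hζ => by rw [← hsub ζ hζ]; simp; ring) hopen hconv
  exact fun ζ hζ => ⟨hsub ζ hζ, hadd ζ hζ⟩

/-! ### Transfer between the disk and the half-plane. -/

/-- The Cayley transform from the right half-plane to the unit disk. -/
noncomputable def cayley (ζ : ℂ) : ℂ := (ζ - 1) / (ζ + 1)

lemma add_one_ne_zero_of_mem {ζ : ℂ} (hζ : ζ ∈ rightHalfPlane) : ζ + 1 ≠ 0 := by
  intro h
  have h1 := congrArg re h
  have h2 : 0 < ζ.re := hζ
  simp at h1
  linarith

lemma norm_cayley_lt_one {ζ : ℂ} (hζ : ζ ∈ rightHalfPlane) : ‖cayley ζ‖ < 1 := by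
  rw [cayley, norm_div, div_lt_one (norm_pos_iff.2 (add_one_ne_zero_of_mem hζ))]
  simpa using norm_sub_lt_norm_add_conj hζ (v := 1) (by simp)

lemma hasDerivAt_cayley {ζ : ℂ} (hζ : ζ ∈ rightHalfPlane) :
    HasDerivAt cayley (2 / (ζ + 1) ^ 2) ζ := by
  have h := ((hasDerivAt_id ζ).sub_const 1).div ((hasDerivAt_id ζ).add_const 1)
    (add_one_ne_zero_of_mem hζ)
  refine h.congr_deriv ?_
  simp only [id]
  ring

lemma exists_cayley_eq {z : ℂ} (hz : ‖z‖ < 1) : ∃ ζ ∈ rightHalfPlane, cayley ζ = z := by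
  have hne : 1 - z ≠ 0 := by
    intro h
    rw [sub_eq_zero] at h
    simp [← h] at hz
  refine ⟨(1 + z) / (1 - z), by simpa [rightHalfPlane] using re_moebius_pos (a := 1) (by simp) hz, ?_⟩
  have h2 : (1 + z) / (1 - z) + 1 = 2 / (1 - z) := by field_simp; ring
  rw [cayley, h2]
  field_simp
  ring

lemma one_sub_cayley {ζ : ℂ} (hζ : ζ ∈ rightHalfPlane) : 1 - cayley ζ = 2 / (ζ + 1) := by
  have := add_one_ne_zero_of_mem hζ
  rw [cayley]; field_simp; ring

lemma koebe_cayley {ζ : ℂ} (hζ : ζ ∈ rightHalfPlane) : koebe (cayley ζ) = (ζ ^ 2 - 1) / 4 := by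
  have := add_one_ne_zero_of_mem hζ
  rw [koebe, one_sub_cayley hζ, cayley]; field_simp; ring

lemma ell_cayley {ζ : ℂ} (hζ : ζ ∈ rightHalfPlane) : ell (cayley ζ) = (ζ - 1) / 2 := by
  have := add_one_ne_zero_of_mem hζ
  rw [ell, one_sub_cayley hζ, cayley]; field_simp

lemma mul_mem_unitDisk {c z : ℂ} (hc : ‖c‖ = 1) (hz : ‖z‖ < 1) : c * z ∈ unitDisk := by
  simpa [unitDisk, hc] using hz

/-- The derivative of a rotated function in the coordinate of the right half-plane. -/
lemma hasDerivAt_comp_cayley {φ : ℂ → ℂ} (hφ : DifferentiableOn ℂ φ unitDisk) {c : ℂ}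
    (hc : ‖c‖ = 1) (d : ℂ) {ζ : ℂ} (hζ : ζ ∈ rightHalfPlane) :
    HasDerivAt (fun ζ => d * φ (c * cayley ζ))
      (d * (deriv φ (c * cayley ζ) * (c * (2 / (ζ + 1) ^ 2)))) ζ := by
  have hmem := mul_mem_unitDisk hc (norm_cayley_lt_one hζ)
  have h1 := ((hφ _ hmem).differentiableAt (isOpen_ball.mem_nhds hmem)).hasDerivAt
  have h2 : HasDerivAt (fun ζ => c * cayley ζ) (c * (2 / (ζ + 1) ^ 2)) ζ :=
    (hasDerivAt_cayley hζ).const_mul c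
  exact (HasDerivAt.comp (h₂ := φ) ζ h1 h2).const_mul d

end ConvexHarmonic

open ConvexHarmonic in
theorem theorem2 (f h g : ℂ → ℂ) (hf : ConvexHarmonic.MemKH0 f h g)
    (hk : ∃ μ : ℝ, ConvexHarmonic.IsRotationOf
      (fun z => h z - Complex.exp (-2 * Complex.I * (μ : ℂ)) * g z) ConvexHarmonic.koebe) :
    ConvexHarmonic.IsRotationOf f ConvexHarmonic.halfPlaneMap := by
  obtain ⟨μ, c, hc, hk⟩ := hk
  have hcc : c * conj c = 1 := by
    rw [Complex.mul_conj, Complex.normSq_eq_norm_sq, hc]; simp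
  have hc0 : c ≠ 0 := norm_ne_zero_iff.1 (by rw [hc]; exact one_ne_zero)
  have hc' : ‖conj c‖ = 1 := by rw [Complex.norm_conj, hc]
  have h1mem : (1 : ℂ) ∈ rightHalfPlane := by simp [rightHalfPlane]
  have hcay1 : cayley 1 = 0 := by simp [cayley]
  -- The factors c and conj c make H + conj G equal to c f(conj c · `cayley` ζ).
  set H : ℂ → ℂ := fun ζ => c * h (conj c * cayley ζ) with hH
  set G : ℂ → ℂ := fun ζ => conj c * g (conj c * cayley ζ) with hG
  have hHd := fun ζ (hζ : ζ ∈ rightHalfPlane) =>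
    hasDerivAt_comp_cayley hf.holomorphic_h hc' c hζ
  have hGd := fun ζ (hζ : ζ ∈ rightHalfPlane) =>
    hasDerivAt_comp_cayley hf.holomorphic_g hc' (conj c) hζ
  have himage : (fun ζ => H ζ + conj (G ζ)) '' rightHalfPlane =
      (fun w => c * w) '' (f '' unitDisk) := by
    have hval : ∀ ζ ∈ rightHalfPlane, H ζ + conj (G ζ) = c * f (conj c * cayley ζ) := by
      intro ζ hζ
      rw [hf.decomposition _ (mul_mem_unitDisk hc' (norm_cayley_lt_one hζ))]
      simp [hH, hG, mul_add]
    rw [Set.image_congr hval, Set.image_image]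
    apply Set.Subset.antisymm
    · rintro _ ⟨ζ, hζ, rfl⟩
      exact ⟨_, mul_mem_unitDisk hc' (norm_cayley_lt_one hζ), rfl⟩
    · rintro _ ⟨z, hz, rfl⟩
      have hz' : ‖c * z‖ < 1 := by simpa [unitDisk, hc] using hz
      obtain ⟨ζ, hζ, hζz⟩ := exists_cayley_eq hz'
      refine ⟨ζ, hζ, ?_⟩
      simp only [hζz, ← mul_assoc]
      rw [mul_comm (conj c), hcc, one_mul]
  have key := eq_affine_of_shear_eq_koebe (H := H) (G := G)
    -- Multiplying the hypothesis by e^{iμ} makes the coefficients of h and g conjugate up to sign;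
    -- conj c undoes the rotation.
    (b := Complex.exp (μ * Complex.I) * conj c)
    (by rw [norm_mul, Complex.norm_exp_ofReal_mul_I, hc', one_mul])
    (fun ζ hζ => (hHd ζ hζ).differentiableAt.differentiableWithinAt)
    (fun ζ hζ => (hGd ζ hζ).differentiableAt.differentiableWithinAt)
    (fun ζ hζ => by
      rw [(hHd ζ hζ).deriv, (hGd ζ hζ).deriv, norm_mul, norm_mul, norm_mul c, norm_mul (deriv h _),
        hc, hc']
      have h0 : 0 < ‖conj c * (2 / (ζ + 1) ^ 2)‖ := by
        have h2 := add_one_ne_zero_of_mem hζ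
        have h3 : conj c ≠ 0 := norm_ne_zero_iff.1 (by rw [hc']; exact one_ne_zero)
        exact norm_pos_iff.2 (mul_ne_zero h3 (div_ne_zero two_ne_zero (pow_ne_zero 2 h2)))
      rw [one_mul, one_mul]
      exact mul_lt_mul_of_pos_right (norm_deriv_lt_of_orientationPreserving hf.holomorphic_h
        hf.holomorphic_g hf.decomposition hf.orientationPreserving
        (mul_mem_unitDisk hc' (norm_cayley_lt_one hζ))) h0)
    (fun ζ hζ => by
      have h1 := hk _ (mul_mem_unitDisk hc' (norm_cayley_lt_one hζ))
      rw [← mul_assoc, hcc, one_mul, koebe_cayley hζ] at h1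
      have h2 : conj (Complex.exp (μ * Complex.I)) =
          Complex.exp (μ * Complex.I) * Complex.exp (-2 * Complex.I * μ) := by
        rw [← Complex.exp_conj, ← Complex.exp_add]
        congr 1
        simp
        ring
      rw [map_mul, Complex.conj_conj, h2, mul_assoc _ (conj c) ((ζ ^ 2 - 1) / 4), ← h1]
      simp only [hH, hG]
      linear_combination (Complex.exp (μ * Complex.I) * h (conj c * cayley ζ)
        - Complex.exp (μ * Complex.I) * Complex.exp (-2 * Complex.I * μ)
          * g (conj c * cayley ζ)) * hcc)
    (by simp [hH, hcay1, hf.h_zero]) (by simp [hG, hcay1, hf.g_zero])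
    (by
      rw [(hHd 1 h1mem).deriv, hcay1, mul_zero, hf.deriv_h_zero]
      linear_combination (1 / 2) * hcc)
    (by rw [(hGd 1 h1mem).deriv, hcay1, mul_zero, hf.deriv_g_zero]; ring)
    (by rw [himage]; exact (Homeomorph.mulLeft₀ c hc0).isOpenMap _ hf.isOpen_range)
    (by rw [himage]; exact hf.convex_range.linear_image (LinearMap.mulLeft ℝ c))
  refine ⟨c, hc, fun z hz => ?_⟩
  have hz' : ‖c * z‖ < 1 := by simpa [unitDisk, hc] using hz
  obtain ⟨ζ, hζ, hζz⟩ := exists_cayley_eq hz'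
  obtain ⟨k1, k2⟩ := key ζ hζ
  have hzc : conj c * cayley ζ = z := by
    rw [hζz, ← mul_assoc, mul_comm (conj c), hcc, one_mul]
  rw [← koebe_cayley hζ, hζz] at k1
  rw [← ell_cayley hζ, hζz] at k2
  have e1 : ell (c * z) + koebe (c * z) = 2 * H ζ := by rw [← k1, ← k2]; ring
  have e2 : ell (c * z) - koebe (c * z) = 2 * G ζ := by rw [← k1, ← k2]; ring
  rw [halfPlaneMap, e1, e2, hf.decomposition z hz]
  simp only [hH, hG, hzc, map_mul, Complex.conj_conj, map_ofNat]
  linear_combination (-(h z) - conj (g z)) * hcc
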